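/- Let $k\ge 2$ and let $P_k=\mathbb F_2[x_1,\dots,x_k]$ ($\deg x_i=1$), regarded as a module over the mod-2 Steenrod algebra $\mathcal A$ in the usual way ($P_k=H^*(BV_k;\mathbb F_2)$ for $V_k$ an elementary abelian 2-group of rank $k$), with $GL_k=GL_k(\mathbb F_2)$ acting by linear substitutions of the variables. Let $\mathbb F_2\otimes_{\mathcal A}P_k=P_k/\mathcal A^+P_k$ with the inherited $GL_k$-action, where $\mathcal A^+$ is the ideal of elements of positive degree, and let $(\mathbb F_2\otimes_{\mathcal A}P_k)_n$ be the subspace of classes of homogeneous polynomials of degree $n$. Kameko's squaring operation $$\widetilde{Sq}^0_*:(\mathbb F_2\otimes_{\mathcal A}P_k)_{2d+k}\longrightarrow(\mathbb F_2\otimes_{\mathcal A}P_k)_d$$ is induced by the $\mathbb F_2$-linear map $\phi:P_k\to P_k$ with $\phi(x)=y$ if $x=x_1x_2\cdots x_ky^2$ for a monomial $y$, and $\phi(x)=0$ for every other monomial $x$. For non-negative integers $d$ and $s\ge t$ write $$K_{t,s,d}=(\widetilde{Sq}^0_*)^{s-t}:(\mathbb F_2\otimes_{\mathcal A}P_k)_{k(2^s-1)+2^sd}\longrightarrow(\mathbb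 F_2\otimes_{\mathcal A}P_k)_{k(2^t-1)+2^td}.$$ For $n>0$ let $\alpha(n)$ be the number of ones in the dyadic expansion of $n$, let $\zeta(n)$ be the greatest $u$ with $2^u\mid n$, and set $t(k,d)=\max\{0,\,k-\alpha(d+k)-\zeta(d+k)\}$. Then: 1. For every $d\ge 0$ and every $s\ge k-2$, the map $K_{k-2,s,d}$ is an isomorphism of $GL_k$-modules. 2. $k-2$ is the minimal uniform bound: it is the least integer $t\ge 0$ such that $K_{t,s,d}$ is an isomorphism of $GL_k$-modules for all $d\ge 0$ and all $s\ge t$. 3. For the degree $d=2^k-k+1$ one has $t(k,d)=k-2$, and already for this single $d$, $k-2$ is the least integer $t\ge 0$ such that $K_{t,s,d}$ is an isomorphism of $GL_k$-modules for all $s\ge t$. -/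

import Mathlib

namespace Kameko

open MvPolynomial

/-- The polynomial algebra `P_k = 𝔽₂[x_1, …, x_k] = H^*(BV_k; 𝔽₂)`. -/
abbrev P (k : ℕ) : Type := MvPolynomial (Fin k) (ZMod 2)

/-! ### Steenrod squares -/

/-- The total Steenrod square `f ↦ ∑_i Sq^i(f) T^i`: the ring homomorphism (Cartan formula) which on
the generators of degree one is `x ↦ x + x² T`, i.e. `Sq^0 x = x`, `Sq^1 x = x²`, `Sq^i x = 0` for
`i ≥ 2`. -/
noncomputable def totalSq (k : ℕ) : P k →ₐ[ZMod 2] Polynomial (P k) :=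
  aeval fun j => Polynomial.C (X j) + Polynomial.C (X j ^ 2) * Polynomial.X

/-- The Steenrod square `Sq^i : P_k → P_k`. -/
noncomputable def Sq (k i : ℕ) : Module.End (ZMod 2) (P k) where
  toFun f := (totalSq k f).coeff i
  map_add' f g := by simp
  map_smul' c f := by simp

/-- The operators on `P_k` given by the elements of `𝒜^+`, the ideal of positive-degree elements of
the Steenrod algebra: sums of products of `Sq^i`, `i ≥ 1`. -/
noncomputable def positiveOps (k : ℕ) :
    NonUnitalSubalgebra (ZMod 2) (Module.End (ZMod 2) (P k)) :=
  NonUnitalAlgebra.adjoin (ZMod 2) {θ | ∃ i, 1 ≤ i ∧ θ = Sq k i}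

/-- The subspace `𝒜^+ P_k` of hit polynomials. -/
noncomputable def hit (k : ℕ) : Submodule (ZMod 2) (P k) :=
  Submodule.span (ZMod 2) {h | ∃ θ ∈ positiveOps k, ∃ f : P k, h = θ f}

/-- `𝔽₂ ⊗_𝒜 P_k = P_k / 𝒜^+ P_k`. -/
abbrev Q (k : ℕ) : Type := P k ⧸ hit k

theorem Sq_mem_hit {k i : ℕ} (hi : 1 ≤ i) (f : P k) : Sq k i f ∈ hit k :=
  Submodule.subset_span
    ⟨Sq k i, NonUnitalAlgebra.subset_adjoin (ZMod 2) ⟨i, hi, rfl⟩, f, rfl⟩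

theorem hit_le {k : ℕ} {W : Submodule (ZMod 2) (P k)}
    (h : ∀ i, 1 ≤ i → ∀ f : P k, Sq k i f ∈ W) : hit k ≤ W := by
  refine Submodule.span_le.2 ?_
  rintro _ ⟨θ, hθ, f, rfl⟩
  change θ f ∈ W
  induction hθ using NonUnitalAlgebra.adjoin_induction generalizing f with
  | mem x hx => obtain ⟨i, hi, rfl⟩ := hx; exact h i hi f
  | add x y _ _ hx hy => exact W.add_mem (hx f) (hy f)
  | zero => exact W.zero_mem
  | mul x y _ _ hx _ => exact hx (y f)
  | smul r x _ hx => exact W.smul_mem r (hx f)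

/-! ### The action of the general linear group -/

/-- `GL_k = GL_k(𝔽₂)`. -/
abbrev GLk (k : ℕ) : Type := GL (Fin k) (ZMod 2)

/-- The linear substitution `x_j ↦ ∑_i g_{ij} x_i`. -/
noncomputable def subst (k : ℕ) (g : GLk k) : P k →ₐ[ZMod 2] P k :=
  aeval fun j => ∑ i, C ((g : Matrix (Fin k) (Fin k) (ZMod 2)) i j) * X i

theorem subst_X (k : ℕ) (g : GLk k) (j : Fin k) :
    subst k g (X j) = ∑ i, C ((g : Matrix (Fin k) (Fin k) (ZMod 2)) i j) * X i := by
  simp [subst]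

/-- The action of `GL_k` on `P_k` by linear substitutions. -/
noncomputable def polyRep (k : ℕ) : Representation (ZMod 2) (GLk k) (P k) where
  toFun g := (subst k g).toLinearMap
  map_one' := by
    have h : subst k 1 = AlgHom.id (ZMod 2) (P k) := by
      refine MvPolynomial.algHom_ext fun j => ?_
      rw [subst_X]
      simp [Matrix.one_apply]
    rw [h]; rfl
  map_mul' g h := by
    have h : subst k (g * h) = (subst k g).comp (subst k h) := by
      refine MvPolynomial.algHom_ext fun j => ?_
      simp only [subst_X, AlgHom.comp_apply, map_sum, map_mul, algHom_C, Units.val_mul,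
        Matrix.mul_apply, Finset.sum_mul, Finset.mul_sum, MvPolynomial.algebraMap_eq]
      rw [Finset.sum_comm]
      refine Finset.sum_congr rfl fun i _ => Finset.sum_congr rfl fun l _ => ?_
      ring
    rw [h]; rfl

theorem totalSq_subst (k : ℕ) (g : GLk k) (f : P k) :
    totalSq k (subst k g f) = (totalSq k f).map (subst k g).toRingHom := by
  have h : (totalSq k).comp (subst k g) = (Polynomial.mapAlgHom (subst k g)).comp (totalSq k) := by
    refine MvPolynomial.algHom_ext fun j => ?_
    have hc : ∀ a : ZMod 2, a ^ 2 = a := by decide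
    have hsq : (∑ i, C ((g : Matrix (Fin k) (Fin k) (ZMod 2)) i j) * X i : P k) ^ 2
        = ∑ i, C ((g : Matrix (Fin k) (Fin k) (ZMod 2)) i j) * X i ^ 2 := by
      rw [sum_pow_char 2]
      refine Finset.sum_congr rfl fun i _ => ?_
      rw [mul_pow, ← C_pow, hc]
    have hX : ∀ i, totalSq k (X i)
        = Polynomial.C (X i) + Polynomial.C (X i ^ 2) * Polynomial.X := fun i => by simp [totalSq]
    rw [AlgHom.comp_apply, AlgHom.comp_apply, subst_X, hX]
    simp only [map_sum, map_mul, map_add, map_pow, hX, Polynomial.coe_mapAlgHom,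
      Polynomial.map_C, Polynomial.map_X, RingHom.coe_coe, subst_X]
    simp only [← map_sum, ← map_mul, ← map_pow, hsq]
    simp only [algHom_C, mul_add, Finset.sum_add_distrib, map_sum, map_mul, map_pow,
      Finset.sum_mul, mul_assoc]
    rfl
  exact DFunLike.congr_fun h f

theorem hit_le_comap_polyRep (k : ℕ) (g : GLk k) : hit k ≤ (hit k).comap (polyRep k g) := by
  refine hit_le fun i hi f => ?_
  have h : polyRep k g (Sq k i f) = Sq k i (polyRep k g f) := by
    change subst k g ((totalSq k f).coeff i) = (totalSq k (subst k g f)).coeff i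
    rw [totalSq_subst, Polynomial.coeff_map]
    rfl
  rw [Submodule.mem_comap, h]
  exact Sq_mem_hit hi _

/-- The inherited action of `GL_k` on `𝔽₂ ⊗_𝒜 P_k`. -/
noncomputable def qRep (k : ℕ) : Representation (ZMod 2) (GLk k) (Q k) :=
  (polyRep k).quotient (hit k) (hit_le_comap_polyRep k)

/-- `(𝔽₂ ⊗_𝒜 P_k)_n`: the classes represented by homogeneous polynomials of degree `n`. -/
noncomputable def qDeg (k n : ℕ) : Submodule (ZMod 2) (Q k) :=
  (homogeneousSubmodule (Fin k) (ZMod 2) n).map (hit k).mkQ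

theorem qDeg_le_comap (k n : ℕ) (g : GLk k) : qDeg k n ≤ (qDeg k n).comap (qRep k g) := by
  rintro _ ⟨f, hf, rfl⟩
  refine ⟨subst k g f, ?_, rfl⟩
  have hf' : f.IsHomogeneous n := hf
  have := hf'.aeval (fun j => ∑ i, C ((g : Matrix (Fin k) (Fin k) (ZMod 2)) i j) * X i) (n := 1)
    fun j => IsHomogeneous.sum _ _ _ fun i _ => isHomogeneous_C_mul_X _ _
  rw [one_mul] at this
  exact this

/-- The `GL_k`-module `(𝔽₂ ⊗_𝒜 P_k)_n`. -/
noncomputable def degRep (k n : ℕ) : Representation (ZMod 2) (GLk k) (qDeg k n) :=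
  (qRep k).subrepresentation (qDeg k n) (qDeg_le_comap k n)

/-! ### Kameko's squaring operation -/

/-- The linear map `φ : P_k → P_k` with `φ(x) = y` if `x = x_1 ⋯ x_k y²`, and `φ(x) = 0` for every
other monomial `x`. -/
noncomputable def phi (k : ℕ) : P k →ₗ[ZMod 2] P k :=
  (basisMonomials (Fin k) (ZMod 2)).constr (ZMod 2) fun m =>
    if ∀ i, Odd (m i) then monomial (m.mapRange (fun a => a / 2) rfl) 1 else 0

theorem phi_monomial (k : ℕ) (m : Fin k →₀ ℕ) :
    phi k (monomial m 1) =
      if ∀ i, Odd (m i) then monomial (m.mapRange (fun a => a / 2) rfl) 1 else 0 := by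
  have := (basisMonomials (Fin k) (ZMod 2)).constr_basis (ZMod 2)
    (fun m : Fin k →₀ ℕ => if ∀ i, Odd (m i) then
      (monomial (m.mapRange (fun a => a / 2) rfl) 1 : P k) else 0) m
  rwa [coe_basisMonomials] at this

theorem monomial_eq_smul {k : ℕ} (m : Fin k →₀ ℕ) (c : ZMod 2) :
    (monomial m c : P k) = c • monomial m 1 := by
  rw [smul_monomial, smul_eq_mul, mul_one]

theorem phi_mul_sq (k : ℕ) (a b : P k) : phi k (a * b ^ 2) = phi k a * b := by
  have key : ∀ m n : Fin k →₀ ℕ, phi k (monomial m 1 * monomial n 1 ^ 2)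
      = phi k (monomial m 1) * monomial n 1 := by
    intro m n
    rw [sq, monomial_mul, monomial_mul, one_mul, one_mul, phi_monomial, phi_monomial]
    have hodd : (∀ i, Odd ((m + (n + n)) i)) ↔ ∀ i, Odd (m i) := by
      refine forall_congr' fun i => ?_
      simp only [Finsupp.add_apply, Nat.odd_iff]
      omega
    by_cases h : ∀ i, Odd (m i)
    · rw [if_pos (hodd.2 h), if_pos h, monomial_mul, one_mul]
      congr 2
      ext i
      simp only [Finsupp.mapRange_apply, Finsupp.add_apply]
      omega
    · rw [if_neg (fun h' => h (hodd.1 h')), if_neg h, zero_mul]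
  have key2 : ∀ (n : Fin k →₀ ℕ) (a : P k), phi k (a * monomial n 1 ^ 2)
      = phi k a * monomial n 1 := by
    intro n a
    induction a using MvPolynomial.monomial_add_induction_on with
    | C c =>
      have := key 0 n
      rw [C_apply, monomial_eq_smul 0 c, smul_mul_assoc, map_smul, this,
        map_smul, smul_mul_assoc]
    | monomial_add m c f _ _ hf =>
      rw [monomial_eq_smul m c, add_mul, map_add, map_add, add_mul, hf,
        smul_mul_assoc, map_smul, map_smul, key, smul_mul_assoc]
  induction b using MvPolynomial.induction_on' with
  | monomial n c =>
    have hc : c ^ 2 = c := by revert c; decide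
    rw [monomial_eq_smul n c, smul_pow, hc, mul_smul_comm, map_smul, key2,
      mul_smul_comm]
  | add p q hp hq => rw [add_pow_char, mul_add, map_add, hp, hq, mul_add]

theorem phi_coeff_totalSq_prod (k : ℕ) (E : Finset (Fin k)) (l : ℕ) :
    phi k ((totalSq k (∏ i ∈ E, X i)).coeff l) = if l = 0 then phi k (∏ i ∈ E, X i) else 0 := by
  have hX : ∀ i, totalSq k (X i)
      = Polynomial.C (X i) + Polynomial.C (X i ^ 2) * Polynomial.X := fun i => by simp [totalSq]
  rcases Nat.eq_zero_or_pos l with rfl | hl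
  · rw [map_prod, Polynomial.coeff_zero_prod]
    simp [hX]
  rw [if_neg hl.ne', map_prod]
  simp only [hX]
  rw [Finset.prod_add, Polynomial.finsetSum_coeff, map_sum]
  refine Finset.sum_eq_zero fun S hS => ?_
  rw [Finset.prod_mul_distrib, Finset.prod_const, ← map_prod, ← map_prod, ← mul_assoc, ← map_mul,
    Polynomial.coeff_C_mul_X_pow]
  split_ifs with h
  · obtain ⟨j, hj⟩ : (E \ S).Nonempty := Finset.card_pos.1 (h ▸ hl)
    have hjS : j ∉ S := (Finset.mem_sdiff.1 hj).2
    rw [Finset.prod_pow, phi_mul_sq]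
    have hm : (∏ i ∈ S, X i : P k) = monomial (∑ i ∈ S, Finsupp.single i 1) 1 := by
      simp only [X, monomial_sum_one]
    rw [hm, phi_monomial, if_neg, zero_mul]
    intro hall
    have := hall j
    rw [Finsupp.finsetSum_apply, Finset.sum_eq_zero] at this
    · simp at this
    · intro i hi
      exact Finsupp.single_eq_of_ne (by rintro rfl; exact hjS hi)
  · exact map_zero _

/-- `φ Sq^{2i} = Sq^i φ` and `φ Sq^{2i+1} = 0`. -/
theorem phi_Sq (k j : ℕ) (f : P k) :
    phi k (Sq k j f) = if Even j then Sq k (j / 2) (phi k f) else 0 := by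
  induction f using MvPolynomial.induction_on' with
  | add p q hp hq =>
    rw [map_add, map_add, hp, hq, map_add, map_add]
    split_ifs <;> simp
  | monomial m c =>
    rw [monomial_eq_smul m c]
    suffices H : phi k (Sq k j (monomial m 1))
        = if Even j then Sq k (j / 2) (phi k (monomial m 1)) else 0 by
      rw [map_smul, map_smul, H, map_smul, map_smul]
      split_ifs <;> simp
    set E : Finset (Fin k) := Finset.univ.filter fun i => Odd (m i) with hE
    set g : P k := monomial (m.mapRange (fun a => a / 2) rfl) 1 with hg
    have hm : (monomial m 1 : P k) = (∏ i ∈ E, X i) * g ^ 2 := by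
      have : (∏ i ∈ E, X i : P k) = monomial (∑ i ∈ E, Finsupp.single i 1) 1 := by
        simp only [X, monomial_sum_one]
      rw [this, hg, sq, monomial_mul, monomial_mul, one_mul, one_mul]
      congr 2
      ext i
      rw [Finsupp.add_apply, Finsupp.finsetSum_apply, Finsupp.add_apply, Finsupp.mapRange_apply]
      have : ∑ j ∈ E, (Finsupp.single j 1 : Fin k →₀ ℕ) i = if Odd (m i) then 1 else 0 := by
        simp [Finsupp.single_apply, hE]
      rw [this]
      split_ifs with h
      · rw [Nat.odd_iff] at h; omega
      · rw [Nat.odd_iff] at h; omega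
    have hphiE : phi k (∏ i ∈ E, X i) = 1 ∨ phi k (∏ i ∈ E, X i) = 0 := by
      have : (∏ i ∈ E, X i : P k) = monomial (∑ i ∈ E, Finsupp.single i 1) 1 := by
        simp only [X, monomial_sum_one]
      rw [this, phi_monomial]
      split_ifs with h
      · left
        have h0 : (∑ i ∈ E, Finsupp.single i 1 : Fin k →₀ ℕ).mapRange (fun a => a / 2) rfl = 0 := by
          ext i
          rw [Finsupp.mapRange_apply, Finsupp.finsetSum_apply]
          simp only [Finsupp.single_apply, Finset.sum_ite_eq', Finsupp.coe_zero, Pi.zero_apply]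
          split_ifs <;> rfl
        rw [h0]; rfl
      · right; rfl
    have hsq : ∀ (q : Polynomial (P k)) (b : ℕ),
        (q ^ 2).coeff b = if Even b then q.coeff (b / 2) ^ 2 else 0 := by
      intro q b
      rw [← Polynomial.map_frobenius_expand 2, Polynomial.coeff_map,
        Polynomial.coeff_expand two_pos]
      simp only [even_iff_two_dvd]
      split_ifs
      · rfl
      · exact map_zero _
    have hcoeff : phi k (Sq k j (monomial m 1))
        = phi k (∏ i ∈ E, X i) * (if Even j then Sq k (j / 2) g else 0) := by
      rw [hm]
      change phi k ((totalSq k (_ * g ^ 2)).coeff j) = _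
      rw [map_mul, map_pow, Polynomial.coeff_mul, map_sum,
        Finset.sum_eq_single_of_mem (0, j) (by simp)]
      · rw [hsq]
        split_ifs with h
        · rw [phi_mul_sq, phi_coeff_totalSq_prod, if_pos rfl]; rfl
        · simp
      · rintro ⟨a, b⟩ hab hne
        have ha : a ≠ 0 := by
          rintro rfl
          apply hne
          simpa using hab
        rw [hsq]
        split_ifs with h
        · rw [phi_mul_sq, phi_coeff_totalSq_prod, if_neg ha, zero_mul]
        · simp
    rw [hcoeff, hm, phi_mul_sq]
    rcases hphiE with h | h
    · rw [h, one_mul, one_mul]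
    · simp [h]

theorem hit_le_comap_phi (k : ℕ) : hit k ≤ (hit k).comap (phi k) := by
  refine hit_le fun i hi f => ?_
  rw [Submodule.mem_comap, phi_Sq]
  split_ifs with h
  · obtain ⟨j, rfl⟩ := h
    exact Sq_mem_hit (by omega) _
  · exact Submodule.zero_mem _

/-- Kameko's squaring operation `S̃q^0_* : 𝔽₂ ⊗_𝒜 P_k → 𝔽₂ ⊗_𝒜 P_k`, induced by `φ`; it maps
`(𝔽₂ ⊗_𝒜 P_k)_{2d+k}` to `(𝔽₂ ⊗_𝒜 P_k)_d`. -/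
noncomputable def kamekoSq (k : ℕ) : Module.End (ZMod 2) (Q k) :=
  (hit k).mapQ (hit k) (phi k) (hit_le_comap_phi k)

/-- `(S̃q^0_*)^{s-t}` restricts to an isomorphism of `GL_k`-modules
`(𝔽₂ ⊗_𝒜 P_k)_{k(2^s-1) + 2^s d} → (𝔽₂ ⊗_𝒜 P_k)_{k(2^t-1) + 2^t d}` (used for `t ≤ s`). -/
def IsKamekoIso (k t s d : ℕ) : Prop :=
  ∃ e : Representation.Equiv (degRep k (k * (2 ^ s - 1) + 2 ^ s * d))
      (degRep k (k * (2 ^ t - 1) + 2 ^ t * d)),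
    ∀ z : qDeg k (k * (2 ^ s - 1) + 2 ^ s * d), (e z : Q k) = (kamekoSq k ^ (s - t)) (z : Q k)

/-! ### The number `t(k, d)` -/

/-- The number `α(n)` of ones in the dyadic expansion of `n`. -/
def alpha (n : ℕ) : ℕ := (Nat.digits 2 n).count 1

/-- The greatest `u` such that `2^u` divides `n` (for `n > 0`). -/
def zeta (n : ℕ) : ℕ := padicValNat 2 n

/-- `t(k, d) = max {0, k - α(d + k) - ζ(d + k)}`. -/
def tBound (k d : ℕ) : ℤ := max 0 ((k : ℤ) - alpha (d + k) - zeta (d + k))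

end Kameko

namespace Kameko

open MvPolynomial

/-! ### Steenrod squares of monomials -/

/-! Upper bound. Kameko's map always has the right inverse `psi` at the level of polynomials, so it
is onto in every degree `2d+k`. It is injective once two facts hold modulo hits: monomials of degree
`n = 2d+k` with an even exponent vanish, and `psi` carries hits to hits. The second follows from the
first through the Cartan formula (`NumericallyReduced.psi_Sq_monomial_mem_hit`).

For the first, write such a monomial as `u·y² = u·Sq^r y` with `u = ∏_{j ∈ E} x_j`, `r = deg y` and
`E` proper. Shifting the square onto `u` (the χ-trick) produces only products `∏_{j ∈ E}
x_j^{2^{a_j}}`, so the monomial is hit when none of these has degree `|E| + r`. This is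
`NumericallyReduced`. A count of binary digits shows that it holds when `n+k = 2^a N` with `N ≥ 2`
and `a ≥ k-1` (`numericallyReduced_of_add_eq`). Since `n+k = 2^s(d+k)` in the degrees concerned,
every iterate from level `s ≥ k-1` down to `s-1` is bijective.

Lower bound. For `d = 2^k-k+1`, the source degree at level `s = k-2` contains a spike with a zero
exponent. Spikes are never hit, yet `phi` kills this one, so no positive power of Kameko's map is
injective there.

Equivariance rests on the fact that the coefficient of `x_1⋯x_k` in its image under `g` is `det g =
1` over `𝔽₂` (`phi_subst`). -/

theorem totalSq_X (k : ℕ) (j : Fin k) :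
    totalSq k (X j) = Polynomial.C (X j) + Polynomial.C (X j ^ 2) * Polynomial.X := by
  simp [totalSq]

theorem Sq_mul (k d : ℕ) (u v : P k) :
    Sq k d (u * v) = ∑ p ∈ Finset.HasAntidiagonal.antidiagonal d, Sq k p.1 u * Sq k p.2 v := by
  change (totalSq k (u * v)).coeff d = _
  rw [map_mul, Polynomial.coeff_mul]
  rfl

theorem monomial_eq_prod {k : ℕ} (m : Fin k →₀ ℕ) :
    (monomial m 1 : P k) = ∏ j, X j ^ m j := by
  rw [monomial_eq, C_1, one_mul, Finsupp.prod_fintype _ _ fun _ => pow_zero _]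

theorem totalSq_X_pow (k : ℕ) (j : Fin k) (a : ℕ) :
    totalSq k (X j ^ a) = ∑ i ∈ Finset.range (a + 1),
      Polynomial.C (C (a.choose i : ZMod 2) * X j ^ (a + i)) * Polynomial.X ^ i := by
  rw [map_pow, totalSq_X, add_comm, add_pow]
  refine Finset.sum_congr rfl fun i hi => ?_
  have hi' : i ≤ a := Nat.lt_succ_iff.1 (Finset.mem_range.1 hi)
  have h : a + i = 2 * i + (a - i) := by omega
  rw [h, mul_pow, pow_add, pow_mul]
  simp only [map_mul, map_pow, map_natCast]
  ring

theorem Sq_monomial (k i : ℕ) (m : Fin k →₀ ℕ) :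
    Sq k i (monomial m 1) =
      ∑ p ∈ Fintype.piFinset fun j => Finset.range (m j + 1),
        if ∑ j, p j = i then
          monomial (m + Finsupp.equivFunOnFinite.symm p) (∏ j, ((m j).choose (p j) : ZMod 2))
        else 0 := by
  change (totalSq k (monomial m 1)).coeff i = _
  rw [monomial_eq_prod, map_prod]
  simp only [totalSq_X_pow]
  rw [Finset.prod_univ_sum, Polynomial.finsetSum_coeff]
  refine Finset.sum_congr rfl fun p _ => ?_
  rw [Finset.prod_mul_distrib, ← map_prod, Finset.prod_pow_eq_pow_sum,
    Polynomial.coeff_C_mul_X_pow]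
  simp only [eq_comm (a := i)]
  refine if_congr Iff.rfl ?_ rfl
  rw [Finset.prod_mul_distrib, ← map_prod, monomial_eq_smul, monomial_eq_prod,
    MvPolynomial.smul_eq_C_mul]
  rfl

/-- Working form of the expansion above: only increments whose binomial coefficients are all odd
contribute. -/
theorem Sq_monomial_mem {k i : ℕ} {m : Fin k →₀ ℕ} {W : Submodule (ZMod 2) (P k)}
    (h : ∀ p : Fin k →₀ ℕ, ∑ j, p j = i → (∀ j, ¬ 2 ∣ (m j).choose (p j)) →
      (monomial (m + p) 1 : P k) ∈ W) : Sq k i (monomial m 1) ∈ W := by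
  rw [Sq_monomial]
  refine W.sum_mem fun p _ => ?_
  split_ifs with hp
  · rw [monomial_eq_smul]
    by_cases hc : ∀ j, ¬ 2 ∣ (m j).choose (p j)
    · exact W.smul_mem _ (h (Finsupp.equivFunOnFinite.symm p) hp hc)
    · push Not at hc
      obtain ⟨j, hj⟩ := hc
      rw [Finset.prod_eq_zero (Finset.mem_univ j) ((ZMod.natCast_eq_zero_iff _ _).2 hj), zero_smul]
      exact W.zero_mem
  · exact W.zero_mem

theorem Sq_monomial_mul_mem {k i : ℕ} {m : Fin k →₀ ℕ} {W : Submodule (ZMod 2) (P k)} (v : P k)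
    (h : ∀ p : Fin k →₀ ℕ, ∑ j, p j = i → (∀ j, ¬ 2 ∣ (m j).choose (p j)) →
      monomial (m + p) 1 * v ∈ W) : Sq k i (monomial m 1) * v ∈ W :=
  Sq_monomial_mem (W := W.comap (LinearMap.mulRight (ZMod 2) v)) h

theorem Sq_zero (k : ℕ) (f : P k) : Sq k 0 f = f := by
  induction f using MvPolynomial.induction_on' with
  | add p q hp hq => rw [map_add, hp, hq]
  | monomial m c =>
    rw [monomial_eq_smul, map_smul, Sq_monomial, Finset.sum_eq_single_of_mem 0]
    · have : (Finsupp.equivFunOnFinite.symm 0 : Fin k →₀ ℕ) = 0 := by ext; rfl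
      simp [this]
    · simp
    · intro p _ hp
      refine if_neg fun h => hp ?_
      funext j
      exact Finset.sum_eq_zero_iff.1 h j (Finset.mem_univ j)

theorem Sq_degree_monomial {k : ℕ} (m : Fin k →₀ ℕ) :
    Sq k (∑ j, m j) (monomial m 1) = monomial m 1 ^ 2 := by
  rw [Sq_monomial, Finset.sum_eq_single_of_mem (m : Fin k → ℕ)]
  · rw [if_pos rfl, sq, monomial_mul]
    have : (Finsupp.equivFunOnFinite.symm (m : Fin k → ℕ) : Fin k →₀ ℕ) = m := by ext; rfl
    simp [this]
  · simp
  · intro p hp hne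
    refine if_neg fun h => hne ?_
    have hle : ∀ j ∈ Finset.univ, p j ≤ m j := fun j _ =>
      Nat.lt_succ_iff.1 (Finset.mem_range.1 (Fintype.mem_piFinset.1 hp j))
    funext j
    exact (Finset.sum_eq_sum_iff_of_le hle).1 h j (Finset.mem_univ j)

theorem coeff_sq {k : ℕ} (q : Polynomial (P k)) (b : ℕ) :
    (q ^ 2).coeff (2 * b) = q.coeff b ^ 2 := by
  rw [← Polynomial.map_frobenius_expand 2, Polynomial.coeff_map, mul_comm,
    Polynomial.coeff_expand_mul two_pos]
  rfl

theorem Sq_two_mul_sq (k i : ℕ) (f : P k) : Sq k (2 * i) (f ^ 2) = Sq k i f ^ 2 := by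
  change (totalSq k (f ^ 2)).coeff (2 * i) = _
  rw [map_pow, coeff_sq]
  rfl

theorem mem_of_isHomogeneous {k n : ℕ} {W : Submodule (ZMod 2) (P k)}
    (h : ∀ m : Fin k →₀ ℕ, ∑ j, m j = n → (monomial m 1 : P k) ∈ W) {f : P k}
    (hf : f.IsHomogeneous n) : f ∈ W := by
  rw [f.as_sum]
  refine W.sum_mem fun m hm => ?_
  rw [monomial_eq_smul]
  refine W.smul_mem _ (h m ?_)
  rw [hf.degree_eq_sum_deg_support hm, ← Finsupp.degree_eq_sum]
  rfl

theorem isHomogeneous_monomial_sum {k n : ℕ} {m : Fin k →₀ ℕ} (h : ∑ j, m j = n) :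
    (monomial m 1 : P k).IsHomogeneous n :=
  isHomogeneous_monomial 1 (by rw [Finsupp.degree_eq_sum, h])

theorem isHomogeneous_Sq_monomial (k i : ℕ) (m : Fin k →₀ ℕ) :
    (Sq k i (monomial m 1)).IsHomogeneous (∑ j, m j + i) := by
  change _ ∈ homogeneousSubmodule (Fin k) (ZMod 2) _
  refine Sq_monomial_mem fun p hp _ => isHomogeneous_monomial_sum ?_
  simp [Finset.sum_add_distrib, hp]

/-! ### A criterion for hit monomials -/

/-- The monomial with exponent `m` is a product `∏_{j ∈ E} x_j^{2^{a_j}}`. -/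
def IsPowTwoOn {k : ℕ} (E : Finset (Fin k)) (m : Fin k →₀ ℕ) : Prop :=
  (∀ j ∈ E, ∃ a, m j = 2 ^ a) ∧ ∀ j ∉ E, m j = 0

/-- The coefficient `(2^a choose b)` is odd only for `b = 0` and `b = 2^a`, so squares either keep
or double each exponent. Hence this class of monomials is stable under Steenrod operations. -/
theorem IsPowTwoOn.add {k : ℕ} {E : Finset (Fin k)} {m p : Fin k →₀ ℕ} (hm : IsPowTwoOn E m)
    (hp : ∀ j, ¬ 2 ∣ (m j).choose (p j)) : IsPowTwoOn E (m + p) := by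
  refine ⟨fun j hj => ?_, fun j hj => ?_⟩
  · obtain ⟨a, ha⟩ := hm.1 j hj
    have h := hp j
    rw [ha] at h
    rw [Finsupp.add_apply, ha]
    by_cases h0 : p j = 0
    · exact ⟨a, by rw [h0, add_zero]⟩
    by_cases h1 : p j = 2 ^ a
    · exact ⟨a + 1, by rw [h1, pow_succ, mul_two]⟩
    · exact absurd (Nat.prime_two.dvd_choose_pow h0 h1) h
  · have h := hp j
    rw [hm.2 j hj] at h
    rw [Finsupp.add_apply, hm.2 j hj, zero_add]
    by_contra h0
    exact h (by rw [Nat.choose_eq_zero_of_lt (Nat.pos_of_ne_zero h0)]; exact dvd_zero 2)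

/-- The χ-trick, by induction on `d` instead of through the antipode: modulo the hit element
`Sq^d(uv)`, the product `u·Sq^d v` is a sum of terms `Sq^i u · Sq^{d-i} v` with `i > 0`. -/
theorem monomial_mul_Sq_mem_hit {k : ℕ} {E : Finset (Fin k)} (v : P k) (d : ℕ) :
    ∀ m : Fin k →₀ ℕ, IsPowTwoOn E m →
      (∀ m' : Fin k →₀ ℕ, IsPowTwoOn E m' → ∑ j, m' j ≠ ∑ j, m j + d) →
      monomial m 1 * Sq k d v ∈ hit k := by
  induction d using Nat.strong_induction_on with
  | _ d ih =>
    intro m hm hne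
    rcases Nat.eq_zero_or_pos d with rfl | hd
    · exact absurd rfl (hne m hm)
    have h := Sq_mul k d (monomial m 1) v
    rw [← Finset.add_sum_erase _ _ (show (0, d) ∈ Finset.HasAntidiagonal.antidiagonal d by simp), Sq_zero] at h
    rw [← sub_eq_iff_eq_add] at h
    refine (congrArg (· ∈ hit k) h).mp ?_
    refine (hit k).sub_mem (Sq_mem_hit hd _) ((hit k).sum_mem ?_)
    rintro ⟨i, l⟩ hil
    rw [Finset.mem_erase, Finset.HasAntidiagonal.mem_antidiagonal] at hil
    obtain ⟨hne0, hil⟩ := hil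
    have hi : i ≠ 0 := by
      rintro rfl
      exact hne0 (by simpa using hil)
    refine Sq_monomial_mul_mem _ fun p hp hc => ?_
    -- The forbidden degree is unchanged, since `deg(m+p) + l = deg m + i + l = deg m + d`.
    refine ih l (by simp only at hil; omega) _ (hm.add hc) fun m' hm' => ?_
    have := hne m' hm'
    simp only [Finsupp.add_apply, Finset.sum_add_distrib, hp]
    simp only at hil
    omega

/-- No class `∏_{j ∈ E} x_j y²` of degree `n` with `E` proper survives the passage to
`𝔽₂ ⊗_𝒜 P_k`, for numerical reasons. -/
def NumericallyReduced (k n : ℕ) : Prop :=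
  ∀ (E : Finset (Fin k)) (m : Fin k →₀ ℕ), E ≠ Finset.univ → IsPowTwoOn E m →
    2 * ∑ j, m j ≠ n + E.card

theorem NumericallyReduced.monomial_mem_hit {k n : ℕ} (hn : NumericallyReduced k n)
    {m : Fin k →₀ ℕ} (hm : ∑ j, m j = n) (hodd : ¬ ∀ j, Odd (m j)) :
    (monomial m 1 : P k) ∈ hit k := by
  set E : Finset (Fin k) := Finset.univ.filter fun j => Odd (m j) with hE
  set q : Fin k →₀ ℕ := m.mapRange (fun a => a / 2) rfl with hq
  set u : Fin k →₀ ℕ := m.mapRange (fun a => a % 2) rfl with hu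
  have huE : ∀ j, u j = if j ∈ E then 1 else 0 := by
    intro j
    simp only [hu, hE, Finsupp.mapRange_apply, Finset.mem_filter, Finset.mem_univ, true_and,
      Nat.odd_iff]
    split_ifs <;> omega
  have hmu : m = u + (q + q) := by
    ext j
    simp only [hu, hq, Finsupp.add_apply, Finsupp.mapRange_apply]
    omega
  have hdeg : ∑ j, u j + 2 * ∑ j, q j = n := by
    rw [← hm, Finset.mul_sum, ← Finset.sum_add_distrib]
    refine Finset.sum_congr rfl fun j _ => ?_
    rw [hmu, Finsupp.add_apply, Finsupp.add_apply, two_mul]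
  have hcard : ∑ j, u j = E.card := by simp [huE]
  have hprod : (monomial m 1 : P k) = monomial u 1 * Sq k (∑ j, q j) (monomial q 1) := by
    rw [Sq_degree_monomial, sq, monomial_mul, monomial_mul, one_mul, one_mul, ← hmu]
  rw [hprod]
  refine monomial_mul_Sq_mem_hit (E := E) _ _ _ ⟨fun j hj => ⟨0, by simp [huE, hj]⟩,
    fun j hj => by simp [huE, hj]⟩ fun m' hm' h => ?_
  -- From `∑ m' = |E| + ∑ q` and `n = |E| + 2∑ q` one gets `2∑ m' = n + |E|`.
  refine hn E m' (fun hall => hodd fun j => ?_) hm' (by omega)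
  have : j ∈ E := hall ▸ Finset.mem_univ j
  exact (Finset.mem_filter.1 this).2
/-! ### Numerically reduced degrees -/

/-- The sum of the binary digits. -/
def bitSum (n : ℕ) : ℕ := (Nat.digits 2 n).sum

theorem bitSum_two_mul (n : ℕ) : bitSum (2 * n) = bitSum n := by
  rcases Nat.eq_zero_or_pos n with rfl | h
  · rfl
  · rw [bitSum, Nat.digits_def' one_lt_two (by omega)]
    simp [bitSum]

theorem bitSum_two_mul_add_one (n : ℕ) : bitSum (2 * n + 1) = bitSum n + 1 := by
  rw [bitSum, Nat.digits_def' one_lt_two (by omega)]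
  have h1 : (2 * n + 1) % 2 = 1 := by omega
  have h2 : (2 * n + 1) / 2 = n := by omega
  rw [h1, h2, List.sum_cons, bitSum, add_comm]

theorem bitSum_succ_le (n : ℕ) : bitSum (n + 1) ≤ bitSum n + 1 := by
  induction n using Nat.strong_induction_on with
  | _ n ih =>
    obtain ⟨m, rfl | rfl⟩ := n.even_or_odd'
    · rw [bitSum_two_mul_add_one, bitSum_two_mul]
    · rw [bitSum_two_mul_add_one, show 2 * m + 1 + 1 = 2 * (m + 1) by ring, bitSum_two_mul]
      have := ih m (by omega)
      omega

theorem bitSum_add_two_pow_le (a n : ℕ) : bitSum (n + 2 ^ a) ≤ bitSum n + 1 := by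
  induction a generalizing n with
  | zero => exact bitSum_succ_le n
  | succ a ih =>
    obtain ⟨m, rfl | rfl⟩ := n.even_or_odd'
    · rw [pow_succ', ← mul_add, bitSum_two_mul, bitSum_two_mul]
      exact ih m
    · rw [pow_succ', show 2 * m + 1 + 2 * 2 ^ a = 2 * (m + 2 ^ a) + 1 by ring,
        bitSum_two_mul_add_one, bitSum_two_mul_add_one]
      have := ih m
      omega

theorem bitSum_add_le (n m : ℕ) : bitSum (n + m) ≤ bitSum n + m := by
  induction m with
  | zero => exact le_rfl
  | succ m ih =>
    have := bitSum_succ_le (n + m)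
    rw [← add_assoc]
    omega

theorem bitSum_sum_two_pow_le {ι : Type*} (E : Finset ι) (b : ι → ℕ) :
    bitSum (∑ i ∈ E, 2 ^ b i) ≤ E.card := by
  classical
  induction E using Finset.induction_on with
  | empty => simp [bitSum]
  | insert i E hi ih =>
    rw [Finset.sum_insert hi, Finset.card_insert_of_notMem hi, add_comm]
    have := bitSum_add_two_pow_le (b i) (∑ i ∈ E, 2 ^ b i)
    omega

/-- Here `n = 2^a(N-1) + (2^a-1)`: the low part supplies `a` ones, and `N-1 ≥ 1` supplies at least
one more. -/
theorem lt_bitSum_of_add_one_eq {a N n : ℕ} (hN : 2 ≤ N) (h : n + 1 = 2 ^ a * N) :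
    a < bitSum n := by
  induction a generalizing n with
  | zero =>
    rw [pow_zero, one_mul] at h
    obtain ⟨m, rfl⟩ : ∃ m, n = m + 1 := ⟨n - 1, by omega⟩
    clear h
    induction m using Nat.strong_induction_on with
    | _ m ih =>
      obtain ⟨l, rfl | rfl⟩ := m.even_or_odd'
      · rw [bitSum_two_mul_add_one]; omega
      · rw [show 2 * l + 1 + 1 = 2 * (l + 1) by ring, bitSum_two_mul]
        exact ih l (by omega)
  | succ a ih =>
    rw [pow_succ', mul_assoc] at h
    have hpos : 0 < 2 ^ a * N := by positivity
    obtain ⟨m, hm⟩ : ∃ m, m + 1 = 2 ^ a * N := ⟨2 ^ a * N - 1, by omega⟩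
    obtain rfl : n = 2 * m + 1 := by omega
    rw [bitSum_two_mul_add_one]
    have := ih hm
    omega

theorem numericallyReduced_of_add_eq {k n a N : ℕ} (ha : k ≤ a + 1) (hN : 2 ≤ N)
    (hn : n + k = 2 ^ a * N) : NumericallyReduced k n := by
  intro E m hE hm h
  have hcard : E.card < k := by
    have := Finset.card_lt_univ_of_notMem
      (Classical.choose_spec (not_forall.1 fun hall => hE (Finset.eq_univ_iff_forall.2 hall)))
    simpa using this
  have hsum : ∑ j, m j = ∑ j ∈ E, m j :=
    (Finset.sum_subset (Finset.subset_univ E) fun j _ hj => hm.2 j hj).symm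
  have hbits : bitSum (∑ j, m j) ≤ E.card := by
    choose! b hb using hm.1
    rw [hsum, Finset.sum_congr rfl hb]
    exact bitSum_sum_two_pow_le E b
  -- The padding `k-|E|-1` raises `n+|E|` to `2^a N - 1`. Its digit sum is then at most `|E| +
  -- (k-|E|-1) = k-1 ≤ a`, yet it must exceed `a`.
  have h1 := bitSum_add_le (2 * ∑ j, m j) (k - E.card - 1)
  rw [bitSum_two_mul] at h1
  have h2 : a < bitSum (2 * ∑ j, m j + (k - E.card - 1)) :=
    lt_bitSum_of_add_one_eq hN (by omega)
  omega

/-! ### The section of Kameko's map -/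

/-- The exponent `(1, …, 1)`. -/
noncomputable def onesExp (k : ℕ) : Fin k →₀ ℕ := Finsupp.equivFunOnFinite.symm 1

theorem onesExp_apply {k : ℕ} (j : Fin k) : onesExp k j = 1 := rfl

theorem sum_onesExp (k : ℕ) : ∑ j, onesExp k j = k := by simp [onesExp_apply]

/-- The linear map `y ↦ x_1 ⋯ x_k y²`. -/
noncomputable def psi (k : ℕ) : P k →ₗ[ZMod 2] P k where
  toFun y := monomial (onesExp k) 1 * y ^ 2
  map_add' y z := by rw [add_pow_char, mul_add]
  map_smul' c y := by
    have hc : c ^ 2 = c := by revert c; decide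
    rw [smul_pow, hc, mul_smul_comm, RingHom.id_apply]

theorem psi_apply {k : ℕ} (y : P k) : psi k y = monomial (onesExp k) 1 * y ^ 2 := rfl

theorem phi_monomial_onesExp (k : ℕ) : phi k (monomial (onesExp k) 1) = 1 := by
  rw [phi_monomial, if_pos fun j => by rw [onesExp_apply]; exact odd_one]
  have : (onesExp k).mapRange (fun a => a / 2) rfl = 0 := by
    ext j
    rw [Finsupp.mapRange_apply, onesExp_apply]
    rfl
  rw [this]
  rfl

theorem phi_psi (k : ℕ) (y : P k) : phi k (psi k y) = y := by
  rw [psi_apply, phi_mul_sq, phi_monomial_onesExp, one_mul]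

theorem isHomogeneous_psi {k d : ℕ} {y : P k} (hy : y.IsHomogeneous d) :
    (psi k y).IsHomogeneous (2 * d + k) := by
  rw [psi_apply, mul_comm, mul_comm 2 d]
  exact (hy.pow 2).mul (isHomogeneous_monomial_sum (sum_onesExp k))

theorem isHomogeneous_phi {k d : ℕ} {f : P k} (hf : f.IsHomogeneous (2 * d + k)) :
    (phi k f).IsHomogeneous d := by
  change f ∈ (homogeneousSubmodule (Fin k) (ZMod 2) d).comap (phi k)
  refine mem_of_isHomogeneous (fun m hm => ?_) hf
  rw [Submodule.mem_comap, phi_monomial]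
  split_ifs with h
  · refine isHomogeneous_monomial_sum ?_
    have h2 : ∑ j, m j = ∑ j, (2 * (m j / 2) + 1) := Finset.sum_congr rfl fun j _ => by
      have := Nat.odd_iff.1 (h j)
      omega
    rw [Finset.sum_add_distrib, ← Finset.mul_sum] at h2
    simp only [Finset.sum_const, Finset.card_univ, Fintype.card_fin, smul_eq_mul, mul_one] at h2
    simp only [Finsupp.mapRange_apply]
    omega
  · exact Submodule.zero_mem _

theorem psi_phi_monomial {k : ℕ} {m : Fin k →₀ ℕ} (h : ∀ j, Odd (m j)) :
    psi k (phi k (monomial m 1)) = monomial m 1 := by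
  rw [phi_monomial, if_pos h, psi_apply, sq, monomial_mul, monomial_mul, one_mul, one_mul]
  congr 2
  ext j
  have := Nat.odd_iff.1 (h j)
  simp only [Finsupp.add_apply, Finsupp.mapRange_apply, onesExp_apply]
  omega

theorem NumericallyReduced.sub_psi_phi_mem_hit {k n : ℕ} (hn : NumericallyReduced k n) {f : P k}
    (hf : f.IsHomogeneous n) : f - psi k (phi k f) ∈ hit k := by
  change f ∈ (hit k).comap (LinearMap.id - psi k ∘ₗ phi k)
  refine mem_of_isHomogeneous (fun m hm => ?_) hf
  change monomial m 1 - psi k (phi k (monomial m 1)) ∈ hit k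
  by_cases h : ∀ j, Odd (m j)
  · rw [psi_phi_monomial h, sub_self]
    exact Submodule.zero_mem _
  · rw [phi_monomial, if_neg h, map_zero, sub_zero]
    exact hn.monomial_mem_hit hm h

theorem even_of_not_dvd_choose {a b : ℕ} (ha : Even a) (h : ¬ 2 ∣ a.choose b) : Even b := by
  by_contra hb
  apply h
  rw [Nat.dvd_iff_mod_eq_zero]
  have := Choose.choose_modEq_choose_mod_mul_choose_div_nat (p := 2) (n := a) (k := b)
  rw [Nat.even_iff.1 ha, Nat.not_even_iff.1 hb] at this
  simpa [Nat.ModEq] using this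

/-- In the Cartan expansion of `Sq^{2i}(x_1⋯x_k y²)` the leading term is `psi (Sq^i y)`. Every other
term raises some `x_j` to `x_j²` and then multiplies by even powers, so it has an even exponent and
is hit. -/
theorem NumericallyReduced.psi_Sq_monomial_mem_hit {k i : ℕ} {q : Fin k →₀ ℕ}
    (hn : NumericallyReduced k (2 * (∑ j, q j + i) + k)) (hi : 1 ≤ i) :
    psi k (Sq k i (monomial q 1)) ∈ hit k := by
  have h := Sq_mul k (2 * i) (monomial (onesExp k) 1) (monomial q 1 ^ 2)
  rw [← Finset.add_sum_erase _ _
    (show (0, 2 * i) ∈ Finset.HasAntidiagonal.antidiagonal (2 * i) by simp),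
    Sq_zero, Sq_two_mul_sq, ← psi_apply, ← sub_eq_iff_eq_add] at h
  refine (congrArg (· ∈ hit k) h).mp ((hit k).sub_mem (Sq_mem_hit (by omega) _) ((hit k).sum_mem ?_))
  rintro ⟨a, b⟩ hab
  rw [Finset.mem_erase, Finset.HasAntidiagonal.mem_antidiagonal] at hab
  obtain ⟨hne0, hab⟩ := hab
  simp only at hab
  have ha : a ≠ 0 := by
    rintro rfl
    exact hne0 (by simpa using hab)
  refine Sq_monomial_mul_mem _ fun p hp hpc => ?_
  simp only
  rw [sq, monomial_mul, one_mul, mul_comm]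
  refine Sq_monomial_mul_mem _ fun r hr hrc => ?_
  rw [monomial_mul, one_mul]
  refine hn.monomial_mem_hit ?_ fun hall => ?_
  · simp only [Finsupp.add_apply, Finset.sum_add_distrib, hp, hr, sum_onesExp]
    omega
  · obtain ⟨j, hj⟩ : ∃ j, p j ≠ 0 := by
      by_contra! h0
      exact ha (hp.symm.trans (Finset.sum_eq_zero fun j _ => h0 j))
    have hpj : p j = 1 := by
      by_contra h1
      exact hpc j (by rw [onesExp_apply, Nat.choose_eq_zero_of_lt (by omega)]; exact dvd_zero 2)
    have hrj : Even (r j) := even_of_not_dvd_choose (by simp) (hrc j)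
    have := hall j
    simp only [Finsupp.add_apply, onesExp_apply, hpj] at this
    rw [Nat.even_iff] at hrj
    rw [Nat.odd_iff] at this
    omega

theorem NumericallyReduced.psi_mem_hit {k d : ℕ} (hn : NumericallyReduced k (2 * d + k)) {f : P k}
    (hf : f.IsHomogeneous d) (h : f ∈ hit k) : psi k f ∈ hit k := by
  -- The numerical hypothesis controls a single degree, so the generators of the hit space are first
  -- projected to degree `d`.
  suffices H : hit k ≤ (hit k).comap (psi k ∘ₗ homogeneousComponent d) by
    have := H h
    rw [Submodule.mem_comap, LinearMap.comp_apply, homogeneousComponent_of_mem hf, if_pos rfl]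
      at this
    exact this
  refine hit_le fun i hi g => ?_
  rw [Submodule.mem_comap, LinearMap.comp_apply]
  induction g using MvPolynomial.induction_on' with
  | add p q hp hq =>
    simp only [map_add]
    exact (hit k).add_mem hp hq
  | monomial m c =>
    rw [monomial_eq_smul]
    simp only [map_smul]
    refine (hit k).smul_mem _ ?_
    rw [homogeneousComponent_of_mem (isHomogeneous_Sq_monomial k i m)]
    split_ifs with hd
    · subst hd
      exact hn.psi_Sq_monomial_mem_hit hi
    · rw [map_zero]
      exact (hit k).zero_mem

theorem NumericallyReduced.mem_hit_of_phi_mem_hit {k d : ℕ}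
    (hn : NumericallyReduced k (2 * d + k)) {f : P k} (hf : f.IsHomogeneous (2 * d + k))
    (h : phi k f ∈ hit k) : f ∈ hit k := by
  have := (hit k).add_mem (hn.sub_psi_phi_mem_hit hf) (hn.psi_mem_hit (isHomogeneous_phi hf) h)
  rwa [sub_add_cancel] at this

/-! ### Bijectivity of Kameko's map in numerically reduced degrees -/

theorem kamekoSq_mkQ (k : ℕ) (f : P k) :
    kamekoSq k ((hit k).mkQ f) = (hit k).mkQ (phi k f) := rfl

theorem mapsTo_kamekoSq (k d : ℕ) : Set.MapsTo (kamekoSq k) (qDeg k (2 * d + k)) (qDeg k d) := by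
  rintro _ ⟨f, hf, rfl⟩
  exact ⟨phi k f, isHomogeneous_phi hf, rfl⟩

theorem surjOn_kamekoSq (k d : ℕ) : Set.SurjOn (kamekoSq k) (qDeg k (2 * d + k)) (qDeg k d) := by
  rintro _ ⟨f, hf, rfl⟩
  exact ⟨(hit k).mkQ (psi k f), ⟨psi k f, isHomogeneous_psi hf, rfl⟩, by
    rw [kamekoSq_mkQ, phi_psi]⟩

theorem NumericallyReduced.injOn_kamekoSq {k d : ℕ} (hn : NumericallyReduced k (2 * d + k)) :
    Set.InjOn (kamekoSq k) (qDeg k (2 * d + k)) := by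
  intro x hx y hy hxy
  rw [← sub_eq_zero, ← map_sub] at hxy
  rw [← sub_eq_zero]
  obtain ⟨f, hf, hfe⟩ := (qDeg k (2 * d + k)).sub_mem hx hy
  rw [← hfe] at hxy ⊢
  rw [kamekoSq_mkQ] at hxy
  rw [Submodule.mkQ_apply, Submodule.Quotient.mk_eq_zero] at hxy ⊢
  exact hn.mem_hit_of_phi_mem_hit hf hxy

theorem NumericallyReduced.bijOn_kamekoSq {k d : ℕ} (hn : NumericallyReduced k (2 * d + k)) :
    Set.BijOn (kamekoSq k) (qDeg k (2 * d + k)) (qDeg k d) :=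
  ⟨mapsTo_kamekoSq k d, hn.injOn_kamekoSq, surjOn_kamekoSq k d⟩

theorem degree_succ (k s d : ℕ) :
    k * (2 ^ (s + 1) - 1) + 2 ^ (s + 1) * d = 2 * (k * (2 ^ s - 1) + 2 ^ s * d) + k := by
  obtain ⟨c, hc⟩ : ∃ c, 2 ^ s = c + 1 := ⟨2 ^ s - 1, by have := Nat.one_le_two_pow (n := s); omega⟩
  rw [pow_succ', hc, show 2 * (c + 1) - 1 = 2 * c + 1 by omega, Nat.add_sub_cancel]
  ring

theorem degree_add (k s d : ℕ) : k * (2 ^ s - 1) + 2 ^ s * d + k = 2 ^ s * (d + k) := by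
  obtain ⟨c, hc⟩ : ∃ c, 2 ^ s = c + 1 := ⟨2 ^ s - 1, by have := Nat.one_le_two_pow (n := s); omega⟩
  rw [hc, Nat.add_sub_cancel]
  ring

theorem bijOn_kamekoSq_pow {k : ℕ} (hk : 2 ≤ k) (d : ℕ) {s : ℕ} (hs : k - 2 ≤ s) :
    Set.BijOn (kamekoSq k ^ (s - (k - 2))) (qDeg k (k * (2 ^ s - 1) + 2 ^ s * d))
      (qDeg k (k * (2 ^ (k - 2) - 1) + 2 ^ (k - 2) * d)) := by
  induction s, hs using Nat.le_induction with
  | base =>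
    rw [Nat.sub_self, pow_zero]
    exact Set.bijOn_id _
  | succ s hs ih =>
    rw [Nat.succ_sub hs, pow_succ, Module.End.coe_mul]
    refine Set.BijOn.comp ih ?_
    have hn : NumericallyReduced k (k * (2 ^ (s + 1) - 1) + 2 ^ (s + 1) * d) :=
      -- The step leaves level `s+1 ≥ k-1`, which is exactly `k ≤ a+1`; this is why the bound is
      -- `k-2`. The cofactor is `N = d+k`.
      numericallyReduced_of_add_eq (a := s + 1) (by omega) (by omega : 2 ≤ d + k)
        (degree_add k (s + 1) d)
    rw [degree_succ] at hn ⊢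
    exact hn.bijOn_kamekoSq

/-! ### Equivariance of Kameko's map -/

theorem phi_eq_zero_of_isHomogeneous {k n : ℕ} {f : P k} (hf : f.IsHomogeneous n) (hn : n < k) :
    phi k f = 0 := by
  change f ∈ LinearMap.ker (phi k)
  refine mem_of_isHomogeneous (fun m hm => ?_) hf
  rw [LinearMap.mem_ker, phi_monomial, if_neg]
  intro h
  have : ∑ j : Fin k, 1 ≤ ∑ j, m j := Finset.sum_le_sum fun j _ => (h j).pos
  simp at this
  omega

theorem isHomogeneous_subst {k n : ℕ} (g : GLk k) {f : P k} (hf : f.IsHomogeneous n) :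
    (subst k g f).IsHomogeneous n := by
  have := hf.aeval (fun j => ∑ i, C ((g : Matrix (Fin k) (Fin k) (ZMod 2)) i j) * X i) (n := 1)
    fun j => IsHomogeneous.sum _ _ _ fun i _ => isHomogeneous_C_mul_X _ _
  rwa [one_mul] at this

theorem phi_prod_X_comp {k : ℕ} (σ : Fin k → Fin k) :
    phi k (∏ j, X (σ j)) = if Function.Bijective σ then 1 else 0 := by
  split_ifs with h
  · rw [h.prod_comp (fun j => (X j : P k)), ← phi_monomial_onesExp, monomial_eq_prod]
    simp [onesExp_apply]
  · have hm : (∏ j, X (σ j) : P k) = monomial (∑ j, Finsupp.single (σ j) 1) 1 := by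
      simp only [X, monomial_sum_one]
    rw [hm, phi_monomial, if_neg]
    intro hodd
    refine h (Finite.injective_iff_bijective.1 (Finite.injective_iff_surjective.2 fun i => ?_))
    by_contra! hi
    have := hodd i
    rw [Finsupp.finsetSum_apply, Finset.sum_eq_zero] at this
    · simp at this
    · intro j _
      exact Finsupp.single_eq_of_ne (Ne.symm (hi j))

theorem phi_subst_prod_X (k : ℕ) (g : GLk k) : phi k (subst k g (∏ j, X j)) = 1 := by
  classical
  set A : Matrix (Fin k) (Fin k) (ZMod 2) := g.val with hA
  have hdet : A.det = 1 := by
    have hu : IsUnit A.det := (Matrix.isUnit_iff_isUnit_det A).1 g.isUnit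
    have : ∀ c : ZMod 2, c ≠ 0 → c = 1 := by decide
    exact this _ hu.ne_zero
  -- In characteristic 2 the permanent equals the determinant.
  have hsum : ∑ σ : Equiv.Perm (Fin k), ∏ j, A (σ j) j = 1 := by
    rw [← hdet, Matrix.det_apply]
    refine Finset.sum_congr rfl fun σ _ => ?_
    rcases Int.units_eq_one_or (Equiv.Perm.sign σ) with h | h
    · rw [h, one_smul]
    · rw [h, Units.neg_smul, one_smul, CharTwo.neg_eq]
  rw [map_prod]
  simp only [subst_X]
  rw [Finset.prod_univ_sum, map_sum, Fintype.piFinset_univ]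
  have hterm : ∀ σ : Fin k → Fin k, phi k (∏ j, C (A (σ j) j) * X (σ j)) =
      if Function.Bijective σ then C (∏ j, A (σ j) j) else 0 := by
    intro σ
    rw [Finset.prod_mul_distrib, ← map_prod, ← smul_eq_C_mul, map_smul, phi_prod_X_comp]
    split_ifs
    · rw [smul_eq_C_mul, mul_one]
    · rw [smul_zero]
  rw [Finset.sum_congr rfl fun σ _ => hterm σ, ← Finset.sum_filter, ← map_sum]
  rw [← C_1, ← hsum]
  congr 1
  symm
  refine Finset.sum_bij (fun σ _ => (σ : Fin k → Fin k)) ?_ ?_ ?_ ?_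
  · intro σ _
    exact Finset.mem_filter.2 ⟨Finset.mem_univ _, σ.bijective⟩
  · intro σ _ τ _ h
    exact DFunLike.coe_injective h
  · intro f hf
    exact ⟨Equiv.ofBijective f (Finset.mem_filter.1 hf).2, Finset.mem_univ _, rfl⟩
  · intro σ _
    rfl

/-- Split a monomial as `u·y²` with `u` squarefree; the square passes through both maps. If `u =
x_1⋯x_k`, the determinant computation applies; otherwise `deg u < k`, and both sides vanish for
degree reasons. -/
theorem phi_subst (k : ℕ) (g : GLk k) (f : P k) :
    phi k (subst k g f) = subst k g (phi k f) := by
  induction f using MvPolynomial.induction_on' with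
  | add p q hp hq => simp only [map_add, hp, hq]
  | monomial m c =>
    rw [monomial_eq_smul]
    simp only [map_smul]
    congr 1
    set q : Fin k →₀ ℕ := m.mapRange (fun a => a / 2) rfl with hq
    set u : Fin k →₀ ℕ := m.mapRange (fun a => a % 2) rfl with hu
    have hm : (monomial m 1 : P k) = monomial u 1 * monomial q 1 ^ 2 := by
      rw [sq, monomial_mul, monomial_mul, one_mul, one_mul]
      congr 2
      ext j
      simp only [hu, hq, Finsupp.add_apply, Finsupp.mapRange_apply]
      omega
    rw [hm, map_mul, map_pow, phi_mul_sq, phi_mul_sq, map_mul]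
    congr 1
    by_cases h : ∀ j, u j = 1
    · have hu1 : u = onesExp k := by
        ext j
        rw [h, onesExp_apply]
      rw [hu1, phi_monomial_onesExp, map_one (subst k g)]
      have h2 : (monomial (onesExp k) 1 : P k) = ∏ j, X j := by
        rw [monomial_eq_prod]
        simp [onesExp_apply]
      rw [h2, phi_subst_prod_X]
    · have hle : ∀ j, u j ≤ 1 := fun j => Nat.lt_succ_iff.1 (Nat.mod_lt _ two_pos)
      push Not at h
      obtain ⟨j, hj⟩ := h
      have hlt : ∑ j, u j < k := by
        have : ∑ j, u j < ∑ _j : Fin k, 1 :=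
          Finset.sum_lt_sum (fun i _ => hle i) ⟨j, Finset.mem_univ j, lt_of_le_of_ne (hle j) hj⟩
        simpa using this
      have hhom := isHomogeneous_monomial_sum (m := u) rfl
      rw [phi_eq_zero_of_isHomogeneous hhom hlt,
        phi_eq_zero_of_isHomogeneous (isHomogeneous_subst g hhom) hlt, map_zero]

theorem kamekoSq_qRep (k : ℕ) (g : GLk k) (z : Q k) :
    kamekoSq k (qRep k g z) = qRep k g (kamekoSq k z) := by
  obtain ⟨f, rfl⟩ := (hit k).mkQ_surjective z
  exact congrArg (hit k).mkQ (phi_subst k g f)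

theorem kamekoSq_pow_qRep (k a : ℕ) (g : GLk k) (z : Q k) :
    (kamekoSq k ^ a) (qRep k g z) = qRep k g ((kamekoSq k ^ a) z) := by
  induction a generalizing z with
  | zero => rfl
  | succ a ih => rw [pow_succ, Module.End.mul_apply, kamekoSq_qRep, ih, Module.End.mul_apply]

theorem isKamekoIso_of_bijOn {k t s d : ℕ}
    (h : Set.BijOn (kamekoSq k ^ (s - t)) (qDeg k (k * (2 ^ s - 1) + 2 ^ s * d))
      (qDeg k (k * (2 ^ t - 1) + 2 ^ t * d))) : IsKamekoIso k t s d := by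
  set F := (kamekoSq k ^ (s - t)).restrict h.mapsTo with hF
  have hbij : Function.Bijective F := by
    refine ⟨fun x y hxy => Subtype.ext (h.injOn x.2 y.2 (congrArg Subtype.val hxy)), fun y => ?_⟩
    obtain ⟨x, hx, hxy⟩ := h.surjOn y.2
    exact ⟨⟨x, hx⟩, Subtype.ext hxy⟩
  refine ⟨Representation.Equiv.mk (LinearEquiv.ofBijective F hbij) fun g => ?_, fun z => rfl⟩
  refine LinearMap.ext fun z => Subtype.ext ?_
  exact kamekoSq_pow_qRep k (s - t) g z

theorem isKamekoIso_of_sub_two_le {k : ℕ} (hk : 2 ≤ k) (d : ℕ) {s : ℕ} (hs : k - 2 ≤ s) :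
    IsKamekoIso k (k - 2) s d :=
  isKamekoIso_of_bijOn (bijOn_kamekoSq_pow hk d hs)

/-! ### Spikes -/

/-- All binary digits of `m+i` below position `a` are 1. At the lowest nonzero digit of `i` there is
no carry, so `m` has digit 0 there, and Lucas gives an even coefficient. -/
theorem two_dvd_choose_of_add_add_one_eq_two_pow {a m i : ℕ} (hi : i ≠ 0)
    (h : m + i + 1 = 2 ^ a) : 2 ∣ m.choose i := by
  induction a generalizing m i with
  | zero => rw [pow_zero] at h; omega
  | succ a ih =>
    rw [pow_succ'] at h
    have hmod := Choose.choose_modEq_choose_mod_mul_choose_div_nat (p := 2) (n := m) (k := i)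
    refine (Nat.ModEq.dvd_iff hmod dvd_rfl).2 ?_
    rcases Nat.mod_two_eq_zero_or_one i with h0 | h1
    · exact Dvd.dvd.mul_left (ih (by omega) (by omega)) _
    · have : m % 2 = 0 := by omega
      rw [h1, this]
      simp

/-- The coefficient of a spike vanishes in every `Sq^i f` with `i ≥ 1`, so it defines a functional
that kills all hits but not the spike. -/
theorem spike_notMem_hit {k : ℕ} {e : Fin k →₀ ℕ} (he : ∀ j, ∃ a, e j + 1 = 2 ^ a) :
    (monomial e 1 : P k) ∉ hit k := by
  intro hmem
  suffices H : hit k ≤ LinearMap.ker (lcoeff (ZMod 2) e) by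
    have := H hmem
    rw [LinearMap.mem_ker, lcoeff_apply, coeff_monomial, if_pos rfl] at this
    exact one_ne_zero this
  refine hit_le fun i hi f => ?_
  induction f using MvPolynomial.induction_on' with
  | add p q hp hq =>
    rw [map_add]
    exact Submodule.add_mem _ hp hq
  | monomial m c =>
    rw [monomial_eq_smul, map_smul]
    refine Submodule.smul_mem _ _ (Sq_monomial_mem fun p hp hc => ?_)
    rw [LinearMap.mem_ker, lcoeff_apply, coeff_monomial, if_neg]
    rintro rfl
    obtain ⟨j, hj⟩ : ∃ j, p j ≠ 0 := by
      by_contra! h0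
      rw [Finset.sum_eq_zero fun j _ => h0 j] at hp
      omega
    obtain ⟨a, ha⟩ := he j
    exact hc j (two_dvd_choose_of_add_add_one_eq_two_pow hj ha)

theorem sum_range_two_pow_sub_one (l : ℕ) :
    ∑ i ∈ Finset.range l, (2 ^ (i + 1) - 1) + (l + 2) = 2 ^ (l + 1) := by
  induction l with
  | zero => rfl
  | succ l ih =>
    rw [Finset.sum_range_succ, pow_succ 2 (l + 1)]
    have := Nat.one_le_two_pow (n := l + 1)
    omega

theorem exists_spike (l : ℕ) : ∃ e : Fin (l + 3) →₀ ℕ, (∀ j, ∃ a, e j + 1 = 2 ^ a) ∧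
    e (Fin.last _) = 0 ∧ ∑ j, e j + (l + 3) = 2 ^ (l + 1) * (2 ^ (l + 3) + 1) := by
  -- With `k = l+3`, the target `2^{2l+4} + 2^{l+1}` is split into `k` powers of two through
  -- `2^{l+1} = 2^l + ⋯ + 2 + 1 + 1`. The final summand 1 gives the zero exponent.
  set b : ℕ → ℕ := fun i => if i = 0 then 2 * l + 4 else if i ≤ l then i else 0 with hb
  refine ⟨Finsupp.equivFunOnFinite.symm fun j => 2 ^ b j - 1, fun j => ⟨b j, ?_⟩, ?_, ?_⟩
  · exact Nat.sub_add_cancel Nat.one_le_two_pow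
  · simp [hb]
  · have h1 := Fin.sum_univ_eq_sum_range (fun i => 2 ^ b i - 1) (l + 3)
    have h2 : ∑ i ∈ Finset.range l, (2 ^ b (i + 1) - 1)
        = ∑ i ∈ Finset.range l, (2 ^ (i + 1) - 1) :=
      Finset.sum_congr rfl fun i hi => by
        have := Finset.mem_range.1 hi
        simp only [hb]
        rw [if_neg (by omega), if_pos (by omega)]
    have h3 := sum_range_two_pow_sub_one l
    have h4 : b (l + 2) = 0 := by simp [hb]
    have h5 : b (l + 1) = 0 := by simp [hb]
    have h6 : b 0 = 2 * l + 4 := by simp [hb]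
    rw [Finset.sum_range_succ, Finset.sum_range_succ, Finset.sum_range_succ', h2, h4, h5, h6] at h1
    have h7 : 2 ^ (l + 1) * (2 ^ (l + 3) + 1) = 2 ^ (2 * l + 4) + 2 ^ (l + 1) := by ring
    have h8 := Nat.one_le_two_pow (n := 2 * l + 4)
    change ∑ j : Fin (l + 3), (2 ^ b j - 1) + (l + 3) = _
    rw [h1, h7, pow_zero]
    omega

theorem not_isKamekoIso {k t : ℕ} (ht : t < k - 2) :
    ¬ IsKamekoIso k t (k - 2) (2 ^ k - k + 1) := by
  obtain ⟨l, rfl⟩ : ∃ l, k = l + 3 := ⟨k - 3, by omega⟩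
  rintro ⟨e, he⟩
  obtain ⟨m, hspike, hlast, hsum⟩ := exists_spike l
  have hlt : l + 3 < 2 ^ (l + 3) := Nat.lt_two_pow_self
  have hd : 2 ^ (l + 3) - (l + 3) + 1 + (l + 3) = 2 ^ (l + 3) + 1 := by omega
  have hdeg := degree_add (l + 3) (l + 1) (2 ^ (l + 3) - (l + 3) + 1)
  rw [hd] at hdeg
  have hhom := isHomogeneous_monomial_sum (m := m)
    (n := (l + 3) * (2 ^ (l + 1) - 1) + 2 ^ (l + 1) * (2 ^ (l + 3) - (l + 3) + 1)) (by omega)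
  -- Since `t < k-2`, Kameko's map is applied at least once, and its first application already kills
  -- the spike.
  obtain ⟨a, ha⟩ : ∃ a, l + 3 - 2 - t = a + 1 := ⟨l - t, by omega⟩
  have hphi : phi (l + 3) (monomial m 1) = 0 := by
    rw [phi_monomial, if_neg]
    intro h
    have := h (Fin.last _)
    rw [hlast] at this
    simp at this
  have hzero : (kamekoSq (l + 3) ^ (l + 3 - 2 - t)) ((hit (l + 3)).mkQ (monomial m 1)) = 0 := by
    rw [ha, pow_succ, Module.End.mul_apply, kamekoSq_mkQ, hphi, map_zero, map_zero]
  have hz := (he ⟨(hit (l + 3)).mkQ (monomial m 1), ⟨monomial m 1, hhom, rfl⟩⟩).trans hzero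
  have h0 := (map_eq_zero_iff e e.injective).1 (Subtype.ext hz)
  have h1 := congrArg Subtype.val h0
  exact spike_notMem_hit hspike ((Submodule.Quotient.mk_eq_zero _).1 h1)

/-! ### The value of `t(k, d)` at `d + k = 2^k + 1` -/

theorem alpha_two_pow (a : ℕ) : alpha (2 ^ a) = 1 := by
  induction a with
  | zero => simp [alpha]
  | succ a ih =>
    have := Nat.two_pow_pos a
    rw [alpha, pow_succ', Nat.digits_def' one_lt_two (by omega), Nat.mul_mod_right,
      Nat.mul_div_cancel_left _ two_pos, List.count_cons_of_ne (by norm_num)]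
    exact ih

theorem tBound_two_pow_sub {k : ℕ} (hk : 2 ≤ k) : tBound k (2 ^ k - k + 1) = (k : ℤ) - 2 := by
  obtain ⟨l, rfl⟩ : ∃ l, k = l + 2 := ⟨k - 2, by omega⟩
  have hlt : l + 2 < 2 ^ (l + 2) := Nat.lt_two_pow_self
  have hd : 2 ^ (l + 2) - (l + 2) + 1 + (l + 2) = 2 * 2 ^ (l + 1) + 1 := by
    rw [← pow_succ', show l + 1 + 1 = l + 2 from rfl]
    generalize 2 ^ (l + 2) = c at *
    omega
  have hz : zeta (2 * 2 ^ (l + 1) + 1) = 0 := padicValNat.eq_zero_of_not_dvd (by omega)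
  have ha : alpha (2 * 2 ^ (l + 1) + 1) = 2 := by
    rw [alpha, Nat.digits_def' one_lt_two (by omega),
      show (2 * 2 ^ (l + 1) + 1) % 2 = 1 by omega,
      show (2 * 2 ^ (l + 1) + 1) / 2 = 2 ^ (l + 1) by omega, List.count_cons_self]
    exact congrArg (· + 1) (alpha_two_pow (l + 1))
  rw [tBound, hd, hz, ha]
  push_cast
  omega

end Kameko

theorem mainTheorem6 (k : ℕ) (hk : 2 ≤ k) :
    (∀ d s : ℕ, k - 2 ≤ s → Kameko.IsKamekoIso k (k - 2) s d) ∧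
    IsLeast {t : ℕ | ∀ d s : ℕ, t ≤ s → Kameko.IsKamekoIso k t s d} (k - 2) ∧
    Kameko.tBound k (2 ^ k - k + 1) = (k : ℤ) - 2 ∧
    IsLeast {t : ℕ | ∀ s : ℕ, t ≤ s → Kameko.IsKamekoIso k t s (2 ^ k - k + 1)} (k - 2) := by
  have hiso : ∀ d s : ℕ, k - 2 ≤ s → Kameko.IsKamekoIso k (k - 2) s d := fun d _ hs =>
    Kameko.isKamekoIso_of_sub_two_le hk d hs
  have hmin : ∀ t : ℕ, (∀ s : ℕ, t ≤ s → Kameko.IsKamekoIso k t s (2 ^ k - k + 1)) →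
      k - 2 ≤ t := fun t ht => by
    by_contra! hlt
    exact Kameko.not_isKamekoIso hlt (ht _ hlt.le)
  exact ⟨hiso, ⟨hiso, fun t ht => hmin t (ht _)⟩, Kameko.tBound_two_pow_sub hk,
    ⟨hiso _, fun t ht => hmin t ht⟩⟩
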